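/- Let $n\ge 0$ and let $\mathcal{G}$ be a group of invertible matrices in $M_n(\mathbb{C})$ which is completely reducible, i.e. $\mathbb{C}^n$ is a direct sum of $\mathcal{G}$-invariant subspaces on which $\mathcal{G}$ acts irreducibly. Suppose that every non-abelian subquotient $\mathcal{H}/\mathcal{N}$ of $\mathcal{G}$ (where $\mathcal{H}$ is a subgroup of $\mathcal{G}$ and $\mathcal{N}$ is a normal subgroup of $\mathcal{H}$) contains a non-central abelian normal subgroup. Let $\mathcal{A}\subseteq M_n(\mathbb{C})$ be a (not necessarily unital) commutative semisimple subalgebra which is $\mathcal{G}$-invariant, i.e. $G^{-1}AG\in\mathcal{A}$ for all $G\in\mathcal{G}$ and $A\in\mathcal{A}$; here semisimple means that there is no nonzero nilpotent two-sided ideal. Then $\mathcal{A}$ is contained in a $\mathcal{G}$-invariant subalgebra $\mathcal{B}$ of $M_n(\mathbb{C})$ which is maximal, with respect to inclusion, among the commutative semisimple subalgebras of $M_n(\mathbb{C})$. If, in addition, every element of $\mathcal{G}$ is unitary and $\mathcal{A}$ is self-adjoint (closed under conjugate transpose), then $\mathcal{B}$ can be chosen to be moreover a masa, i.e. maximal with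 respect to inclusion among the commutative self-adjoint subalgebras of $M_n(\mathbb{C})$. -/

import Mathlib

open scoped Matrix

/-- A non-unital subalgebra `S` of `A` is commutative. -/
def IsCommutativeAlgebra {A : Type*} [Ring A] [Algebra ℂ A]
    (S : NonUnitalSubalgebra ℂ A) : Prop :=
  ∀ a ∈ S, ∀ b ∈ S, a * b = b * a

/-- A (not necessarily unital) subalgebra `S` of a finite-dimensional algebra is semisimple if it
has no nonzero nilpotent two-sided ideal. (`I` ranges over the linear subspaces of `S` that are
two-sided ideals of `S`; nilpotent means that `I ^ k = 0` for some `k`, the power being the span of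
all `k`-fold products.) -/
def IsSemisimpleAlgebra {A : Type*} [Ring A] [Algebra ℂ A]
    (S : NonUnitalSubalgebra ℂ A) : Prop :=
  ∀ I : Submodule ℂ A, I ≤ S.toSubmodule →
    (∀ a ∈ S, ∀ x ∈ I, a * x ∈ I ∧ x * a ∈ I) → IsNilpotent I → I = ⊥

/-- For unital subalgebras of a finite-dimensional algebra this is Mathlib's semisimplicity. -/
theorem isSemisimpleAlgebra_iff_isSemisimpleRing {A : Type*} [Ring A] [Algebra ℂ A]
    [FiniteDimensional ℂ A] (S : Subalgebra ℂ A) :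
    IsSemisimpleAlgebra S.toNonUnitalSubalgebra ↔ IsSemisimpleRing S := by
  constructor
  · intro h
    have : IsArtinianRing S := IsArtinianRing.of_finite ℂ S
    rw [IsArtinianRing.isSemisimpleRing_iff_jacobson]
    obtain ⟨k, hk⟩ := (IsSemiprimaryRing.isNilpotent (R := S))
    have key := h (((Ring.jacobson S).restrictScalars ℂ).map S.val.toLinearMap) ?_ ?_ ?_
    · rw [eq_bot_iff]
      intro x hx
      have hx' : (x : A) ∈ (⊥ : Submodule ℂ A) := by
        rw [← key]
        exact ⟨x, hx, rfl⟩
      exact Subtype.ext hx'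
    · rintro _ ⟨x, -, rfl⟩
      exact x.2
    · rintro a ha _ ⟨x, hx, rfl⟩
      exact ⟨⟨⟨a, ha⟩ * x, Ideal.mul_mem_left _ _ hx, rfl⟩,
        ⟨x * ⟨a, ha⟩, Ideal.mul_mem_right _ _ hx, rfl⟩⟩
    · have hle : ∀ m : ℕ, ((Ring.jacobson S).restrictScalars ℂ) ^ m ≤
          ((Ring.jacobson S) ^ m).restrictScalars ℂ := by
        intro m
        induction m with
        | zero =>
          intro x _
          have hx1 : x ∈ (Ring.jacobson S) ^ 0 := by
            rw [Submodule.pow_zero, Ideal.one_eq_top]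
            trivial
          exact hx1
        | succ m ih =>
          rw [Submodule.pow_succ (M := (Ring.jacobson S).restrictScalars ℂ), Submodule.mul_le]
          intro x hx y hy
          have hx1 : x ∈ Ring.jacobson S ^ m := ih hx
          have hy1 : y ∈ Ring.jacobson S := hy
          exact Ideal.mul_mem_mul hx1 hy1
      refine ⟨k, ?_⟩
      have h0 : ((Ring.jacobson S).restrictScalars ℂ) ^ k = ⊥ := by
        rw [eq_bot_iff]
        refine (hle k).trans ?_
        rw [hk]
        intro x hx
        exact hx
      have := Submodule.map_pow ((Ring.jacobson S).restrictScalars ℂ) S.val k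
      rw [h0, Submodule.map_bot] at this
      exact this.symm
  · intro h I hI hid hn
    obtain ⟨k, hk⟩ := hn
    let J : Ideal S :=
      { carrier := {x | (x : A) ∈ I}
        add_mem' := fun ha hb => I.add_mem ha hb
        zero_mem' := I.zero_mem
        smul_mem' := fun c x hx => (hid c c.2 x hx).1 }
    obtain ⟨e, he, hJ⟩ := IsSemisimpleRing.ideal_eq_span_idempotent J
    have heI : (e : A) ∈ I := by
      have : e ∈ J := by rw [hJ]; exact Ideal.mem_span_singleton_self e
      exact this
    have hpow : (e : A) ^ k = 0 := by
      have := Submodule.pow_mem_pow I heI k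
      rw [hk] at this
      exact this
    have he0 : e = 0 := by
      have h1 : IsNilpotent e := ⟨k, Subtype.ext (by simpa using hpow)⟩
      rcases k with _ | k
      · have : (1 : S) = 0 := Subtype.ext (by simpa using hpow)
        rw [← mul_one e, this, mul_zero]
      · have h2 := he.pow_succ_eq k
        rw [← h2]
        exact Subtype.ext (by simpa using hpow)
    rw [eq_bot_iff]
    intro x hx
    have hxJ : (⟨x, hI hx⟩ : S) ∈ J := hx
    rw [hJ, he0, Ideal.mem_span_singleton'] at hxJ
    obtain ⟨a, ha⟩ := hxJ
    rw [mul_zero] at ha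
    exact (congrArg Subtype.val ha).symm

/-- `S` is a maximal commutative semisimple subalgebra of `M_n(ℂ)`: it is maximal with respect to
inclusion among the commutative semisimple subalgebras. -/
def IsMaximalCommutativeSemisimple {n : ℕ}
    (S : NonUnitalSubalgebra ℂ (Matrix (Fin n) (Fin n) ℂ)) : Prop :=
  Maximal (fun T : NonUnitalSubalgebra ℂ (Matrix (Fin n) (Fin n) ℂ) =>
    IsCommutativeAlgebra T ∧ IsSemisimpleAlgebra T) S

/-- `S` is self-adjoint: closed under the conjugate transpose. -/
def IsSelfAdjointAlgebra {n : ℕ}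
    (S : NonUnitalSubalgebra ℂ (Matrix (Fin n) (Fin n) ℂ)) : Prop :=
  ∀ a ∈ S, aᴴ ∈ S

/-- `S` is a masa in `M_n(ℂ)`: it is maximal with respect to inclusion among the abelian
self-adjoint subalgebras. -/
def IsMasa {n : ℕ} (S : NonUnitalSubalgebra ℂ (Matrix (Fin n) (Fin n) ℂ)) : Prop :=
  Maximal (fun T : NonUnitalSubalgebra ℂ (Matrix (Fin n) (Fin n) ℂ) =>
    IsCommutativeAlgebra T ∧ IsSelfAdjointAlgebra T) S

/-- `S` is invariant under conjugation by every element of `G`. -/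
def IsConjInvariant {n : ℕ} (G : Subgroup (GL (Fin n) ℂ))
    (S : NonUnitalSubalgebra ℂ (Matrix (Fin n) (Fin n) ℂ)) : Prop :=
  ∀ g ∈ G, ∀ a ∈ S,
    ((g⁻¹ : GL (Fin n) ℂ) : Matrix (Fin n) (Fin n) ℂ) * a * (g : Matrix (Fin n) (Fin n) ℂ) ∈ S

/-- The subspace `W` of `ℂⁿ` is mapped into itself by every element of `G`. -/
def IsInvariantSubspace {n : ℕ} (G : Subgroup (GL (Fin n) ℂ))
    (W : Submodule ℂ (Fin n → ℂ)) : Prop :=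
  ∀ g ∈ G, ∀ v ∈ W, (g : Matrix (Fin n) (Fin n) ℂ) *ᵥ v ∈ W

/-- `G` acts irreducibly on the subspace `W` of `ℂⁿ`: `W` is nonzero and `G`-invariant, and it
has no `G`-invariant subspaces other than `0` and `W`. -/
def ActsIrreduciblyOn {n : ℕ} (G : Subgroup (GL (Fin n) ℂ))
    (W : Submodule ℂ (Fin n → ℂ)) : Prop :=
  W ≠ ⊥ ∧ IsInvariantSubspace G W ∧
    ∀ W' : Submodule ℂ (Fin n → ℂ), W' ≤ W → IsInvariantSubspace G W' → W' = ⊥ ∨ W' = W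

/-- `G` is completely reducible: `ℂⁿ` is a (finite) direct sum of `G`-invariant subspaces on which
`G` acts irreducibly. -/
def IsCompletelyReducible {n : ℕ} (G : Subgroup (GL (Fin n) ℂ)) : Prop :=
  ∃ (r : ℕ) (V : Fin r → Submodule ℂ (Fin n → ℂ)),
    DirectSum.IsInternal V ∧ ∀ i, ActsIrreduciblyOn G (V i)

/-- Every element of `G` is a unitary matrix. -/
def IsUnitaryMatrixGroup {n : ℕ} (G : Subgroup (GL (Fin n) ℂ)) : Prop :=
  ∀ g ∈ G, (g : Matrix (Fin n) (Fin n) ℂ) ∈ Matrix.unitaryGroup (Fin n) ℂ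

/-- The group `Q` has a noncentral abelian normal subgroup. -/
def HasNoncentralAbelianNormalSubgroup (Q : Type*) [Group Q] : Prop :=
  ∃ K : Subgroup Q, K.Normal ∧ (∀ x ∈ K, ∀ y ∈ K, x * y = y * x) ∧ ¬ K ≤ Subgroup.center Q

/-- Every non-abelian subquotient `H ⧸ N` of `G` (`H` a subgroup of `G`, `N` a normal subgroup
of `H`) has a noncentral abelian normal subgroup. -/
def SubquotientsHaveNoncentralAbelianNormal (G : Type*) [Group G] : Prop :=
  ∀ (H : Subgroup G) (N : Subgroup H) [N.Normal],
    (¬ ∀ x y : H ⧸ N, x * y = y * x) → HasNoncentralAbelianNormalSubgroup (H ⧸ N)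

/-! Adjoin the unit to the given algebra and enlarge the result to an invariant unital commutative
algebra `B` of semisimple matrices that is maximal among such algebras. It suffices that `B` equals
its own centralizer: every commutative algebra containing `B` then lies in `B`.

Suppose `x` centralizes `B` but is not in `B` (`IsToralInvariant.exists_lt`). Write 1 as a sum of
primitive idempotents of `B`. For some summand `e`, the matrix `x * e` is not a multiple of `e`.
Conjugation by `G` permutes the primitive idempotents, so each conjugate of `e` is `e` or orthogonal
to `e`. Hence it is enough to find a commuting set `C` of semisimple matrices living on the range of
`e`, not all scalar there and invariant under the stabilizer of `e`. The conjugates of `C` commute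
with each other and with `B`, and together with `B` they generate a larger algebra.

If the stabilizer acts reducibly on the range of `e`, complete reducibility yields an equivariant
projection onto an invariant subspace (`exists_refines_of_reducible`). If it acts irreducibly, its
image there is a subquotient of `G`, non-abelian by Schur's lemma because of `x`. A noncentral
abelian normal subgroup of it serves as `C`, and its elements are semisimple by a Clifford-type
argument (`exists_refines_of_irreducible`).

In the unitary case `C` can be taken closed under adjoints, so the construction stays self-adjoint.
Commutative self-adjoint algebras are reduced, hence semisimple, which makes `B` a masa. -/

/-- A square complex matrix is semisimple if it is so as an endomorphism of `ℂⁿ`. -/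
def IsSemisimpleMatrix {n : ℕ} (a : Matrix (Fin n) (Fin n) ℂ) : Prop :=
  Module.End.IsSemisimple (Matrix.toLin' a)

/-! ### Semisimple matrices and conjugation. -/

section Semisimple

variable {n : ℕ} {a b : Matrix (Fin n) (Fin n) ℂ}

theorem aeval_toLin' (p : Polynomial ℂ) :
    Polynomial.aeval (Matrix.toLin' a) p = Matrix.toLin' (Polynomial.aeval a p) :=
  Polynomial.aeval_algHom_apply (Matrix.toLinAlgEquiv' (R := ℂ) (n := Fin n)) a p

theorem isSemisimpleMatrix_of_aeval_eq_zero {p : Polynomial ℂ} (hp : Squarefree p)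
    (h : Polynomial.aeval a p = 0) : IsSemisimpleMatrix a :=
  Module.End.isSemisimple_of_squarefree_aeval_eq_zero hp (by rw [aeval_toLin', h, map_zero])

theorem commute_toLin' (h : Commute a b) : Commute (Matrix.toLin' a) (Matrix.toLin' b) :=
  h.map (Matrix.toLinAlgEquiv' (R := ℂ) (n := Fin n))

theorem IsSemisimpleMatrix.add (ha : IsSemisimpleMatrix a) (hb : IsSemisimpleMatrix b)
    (h : Commute a b) : IsSemisimpleMatrix (a + b) := by
  have := Module.End.IsSemisimple.add_of_commute (commute_toLin' h) ha hb
  rwa [← map_add] at this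

theorem IsSemisimpleMatrix.mul (ha : IsSemisimpleMatrix a) (hb : IsSemisimpleMatrix b)
    (h : Commute a b) : IsSemisimpleMatrix (a * b) := by
  have := Module.End.IsSemisimple.mul_of_commute (commute_toLin' h) ha hb
  rw [Module.End.mul_eq_comp, ← Matrix.toLin'_mul] at this
  exact this

theorem isSemisimpleMatrix_algebraMap (c : ℂ) :
    IsSemisimpleMatrix (algebraMap ℂ (Matrix (Fin n) (Fin n) ℂ) c) :=
  isSemisimpleMatrix_of_aeval_eq_zero (p := Polynomial.X - Polynomial.C c)
    (Polynomial.irreducible_X_sub_C c).squarefree (by simp)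

theorem isSemisimpleMatrix_of_isIdempotentElem (h : a * a = a) : IsSemisimpleMatrix a := by
  refine isSemisimpleMatrix_of_aeval_eq_zero
    (p := Polynomial.X * (Polynomial.X - Polynomial.C 1)) ?_ (by simp [mul_sub, h])
  rw [squarefree_mul_iff]
  refine ⟨?_, Polynomial.irreducible_X.squarefree, (Polynomial.irreducible_X_sub_C 1).squarefree⟩
  have := Polynomial.isCoprime_X_sub_C_of_isUnit_sub (R := ℂ) (a := 0) (b := 1) (by simp)
  rw [Polynomial.C_0, sub_zero] at this
  exact this.isRelPrime

/-- Conjugation by an invertible matrix. -/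
def conjAlgHom (g : GL (Fin n) ℂ) : Matrix (Fin n) (Fin n) ℂ →ₐ[ℂ] Matrix (Fin n) (Fin n) ℂ :=
  AlgHom.ofLinearMap
    (LinearMap.mulLeft ℂ (g : Matrix (Fin n) (Fin n) ℂ) ∘ₗ
      LinearMap.mulRight ℂ ((g⁻¹ : GL (Fin n) ℂ) : Matrix (Fin n) (Fin n) ℂ))
    (by
      change (g : Matrix (Fin n) (Fin n) ℂ) * (1 * _) = 1
      rw [one_mul, Units.mul_inv])
    (fun x y => by
      change (g : Matrix (Fin n) (Fin n) ℂ) * (x * y * _) = g * (x * _) * (g * (y * _))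
      rw [mul_assoc (g : Matrix (Fin n) (Fin n) ℂ), mul_assoc x _ (_ * _), Units.inv_mul_cancel_left,
        mul_assoc x])

theorem conjAlgHom_apply (g : GL (Fin n) ℂ) (a : Matrix (Fin n) (Fin n) ℂ) :
    conjAlgHom g a = (g : Matrix (Fin n) (Fin n) ℂ) * a *
      ((g⁻¹ : GL (Fin n) ℂ) : Matrix (Fin n) (Fin n) ℂ) :=
  (mul_assoc _ _ _).symm

theorem conjAlgHom_one (a : Matrix (Fin n) (Fin n) ℂ) : conjAlgHom 1 a = a := by
  rw [conjAlgHom_apply, inv_one, Units.val_one, one_mul, mul_one]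

theorem conjAlgHom_mul (g h : GL (Fin n) ℂ) (a : Matrix (Fin n) (Fin n) ℂ) :
    conjAlgHom (g * h) a = conjAlgHom g (conjAlgHom h a) := by
  simp only [conjAlgHom_apply, mul_inv_rev, Units.val_mul, mul_assoc]

theorem conjAlgHom_conjAlgHom_inv (g : GL (Fin n) ℂ) (a : Matrix (Fin n) (Fin n) ℂ) :
    conjAlgHom g (conjAlgHom g⁻¹ a) = a := by
  rw [← conjAlgHom_mul, mul_inv_cancel, conjAlgHom_one]

theorem conjAlgHom_eq_self_iff (g : GL (Fin n) ℂ) (a : Matrix (Fin n) (Fin n) ℂ) :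
    conjAlgHom g a = a ↔ Commute (g : Matrix (Fin n) (Fin n) ℂ) a := by
  rw [conjAlgHom_apply, Units.mul_inv_eq_iff_eq_mul]
  rfl

theorem IsSemisimpleMatrix.conj (g : GL (Fin n) ℂ) (ha : IsSemisimpleMatrix a) :
    IsSemisimpleMatrix (conjAlgHom g a) := by
  have h0 : Polynomial.aeval a (minpoly ℂ (Matrix.toLin' a)) = 0 := by
    have := minpoly.aeval ℂ (Matrix.toLin' a)
    rw [aeval_toLin'] at this
    exact (LinearEquiv.map_eq_zero_iff _).1 this
  refine isSemisimpleMatrix_of_aeval_eq_zero (Module.End.IsSemisimple.minpoly_squarefree ha) ?_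
  rw [Polynomial.aeval_algHom_apply, h0, map_zero]

theorem IsSemisimpleMatrix.eq_zero_of_isNilpotent (ha : IsSemisimpleMatrix a)
    (h : IsNilpotent a) : a = 0 := by
  have := Module.End.eq_zero_of_isNilpotent_isSemisimple
    (h.map (Matrix.toLinAlgEquiv' (R := ℂ) (n := Fin n))) ha
  exact (EmbeddingLike.map_eq_zero_iff (f := Matrix.toLinAlgEquiv' (R := ℂ) (n := Fin n))).1 this

/-- The elements of the subalgebra generated by commuting semisimple matrices are semisimple. -/
theorem isSemisimpleMatrix_of_mem_adjoin {s : Set (Matrix (Fin n) (Fin n) ℂ)}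
    (hc : ∀ x ∈ s, ∀ y ∈ s, x * y = y * x) (hs : ∀ x ∈ s, IsSemisimpleMatrix x)
    (ha : a ∈ Algebra.adjoin ℂ s) : IsSemisimpleMatrix a := by
  have hcomm : ∀ x ∈ Algebra.adjoin ℂ s, ∀ y ∈ Algebra.adjoin ℂ s, x * y = y * x := by
    have := Algebra.isMulCommutative_adjoin ℂ hc
    intro x hx y hy
    exact setLike_mul_comm hx hy
  induction ha using Algebra.adjoin_induction with
  | mem x hx => exact hs x hx
  | algebraMap c => exact isSemisimpleMatrix_algebraMap c
  | add x y hx hy h₁ h₂ => exact h₁.add h₂ (hcomm x hx y hy)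
  | mul x y hx hy h₁ h₂ => exact h₁.mul h₂ (hcomm x hx y hy)

/-- In a subalgebra without nonzero nilpotent elements all elements are semisimple. -/
theorem isSemisimpleMatrix_of_reduced {S : NonUnitalSubalgebra ℂ (Matrix (Fin n) (Fin n) ℂ)}
    (hS : ∀ x ∈ S, IsNilpotent x → x = 0) (ha : a ∈ S) : IsSemisimpleMatrix a := by
  classical
  -- The factor `X` makes the radical `r` divisible by `X`, so `r(a)` has no constant term and lies
  -- in the possibly non-unital `S`. It is nilpotent, hence zero, and `r` is squarefree.
  have hm : minpoly ℂ a * Polynomial.X ≠ 0 :=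
    mul_ne_zero (minpoly.ne_zero (Algebra.IsIntegral.isIntegral a)) Polynomial.X_ne_zero
  set r := UniqueFactorizationMonoid.radical (minpoly ℂ a * Polynomial.X) with hr
  have hrs : Squarefree r := UniqueFactorizationMonoid.squarefree_radical
  refine isSemisimpleMatrix_of_aeval_eq_zero hrs (hS _ ?_ ?_)
  · have hX : Polynomial.X ∣ r :=
      (UniqueFactorizationMonoid.dvd_radical_iff_of_irreducible Polynomial.irreducible_X hm).2
        (dvd_mul_left _ _)
    obtain ⟨q, hq⟩ := hX
    rw [hq]
    clear_value r
    clear hq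
    induction q using Polynomial.induction_on' with
    | add p q hp hq => rw [mul_add, map_add]; exact S.add_mem hp hq
    | monomial k c =>
      rw [Polynomial.X_mul_monomial, Polynomial.aeval_monomial, ← Algebra.smul_def]
      refine SMulMemClass.smul_mem c ?_
      induction k with
      | zero => simpa using ha
      | succ k ih => rw [pow_succ]; exact S.mul_mem ih ha
  · obtain ⟨k, hk⟩ : ∃ k, minpoly ℂ a * Polynomial.X ∣ r ^ k :=
      UniqueFactorizationMonoid.exists_dvd_radical_self_pow hm
    refine ⟨k, ?_⟩
    rw [← map_pow]
    obtain ⟨q, hq⟩ := (dvd_mul_right (minpoly ℂ a) Polynomial.X).trans hk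
    rw [hq, map_mul, minpoly.aeval, zero_mul]

end Semisimple

/-! ### Nilpotents in commutative and in self-adjoint algebras. -/

section Algebras

open scoped ComplexOrder

variable {n : ℕ}

/-- A commutative algebra is semisimple if and only if it has no nonzero nilpotent elements. -/
theorem IsCommutativeAlgebra.isSemisimpleAlgebra_iff {A : Type*} [Ring A] [Algebra ℂ A]
    {S : NonUnitalSubalgebra ℂ A} (hS : IsCommutativeAlgebra S) :
    IsSemisimpleAlgebra S ↔ ∀ x ∈ S, IsNilpotent x → x = 0 := by
  constructor
  · rintro h x hx ⟨k, hk⟩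
    -- The generator `x` is listed separately because `S` need not contain 1.
    let I : Submodule ℂ A := Submodule.span ℂ ({x} ∪ {y | ∃ a ∈ S, y = a * x})
    have hI : ∀ a ∈ S, ∀ y ∈ I, a * y ∈ I := by
      intro a ha y hy
      induction hy using Submodule.span_induction with
      | mem y hy =>
        rcases hy with rfl | ⟨b, hb, rfl⟩
        · exact Submodule.subset_span (Or.inr ⟨a, ha, rfl⟩)
        · exact Submodule.subset_span (Or.inr ⟨a * b, S.mul_mem ha hb, by rw [mul_assoc]⟩)
      | zero => rw [mul_zero]; exact I.zero_mem
      | add y z _ _ h₁ h₂ => rw [mul_add]; exact I.add_mem h₁ h₂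
      | smul c y _ h₁ => rw [mul_smul_comm]; exact I.smul_mem c h₁
    have hIS : I ≤ S.toSubmodule := by
      refine Submodule.span_le.2 ?_
      rintro y (rfl | ⟨a, ha, rfl⟩)
      · exact hx
      · exact S.mul_mem ha hx
    -- Each factor from `I` absorbs one power of `x`. At `m = k` this reads `I ^ k = 0`; the
    -- subtraction is truncated, so the claim persists for larger `m`.
    have hpow : ∀ m : ℕ, ∀ y ∈ I ^ m, y * x ^ (k - m) = 0 := by
      intro m
      induction m with
      | zero => intro y _; rw [Nat.sub_zero, hk, mul_zero]
      | succ m ih =>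
        intro y hy
        rw [pow_succ] at hy
        induction hy using Submodule.mul_induction_on' with
        | add y _ z _ h₁ h₂ => rw [add_mul, h₁, h₂, zero_add]
        | mem_mul_mem y hy z hz =>
          have key : ∀ z ∈ I, y * z * x ^ (k - (m + 1)) = 0 := by
            intro z hz
            rcases Nat.lt_or_ge m k with hmk | hmk
            · have he : k - m = k - (m + 1) + 1 := by omega
              have hy0 := ih y hy
              rw [he] at hy0
              induction hz using Submodule.span_induction with
              | mem z hz =>
                rcases hz with rfl | ⟨b, hb, rfl⟩
                · rw [mul_assoc, ← pow_succ', hy0]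
                · rw [hS b hb x hx, ← mul_assoc]
                  have hcb : b * x ^ (k - (m + 1)) = x ^ (k - (m + 1)) * b :=
                    (show Commute b x from hS b hb x hx).pow_right _
                  rw [mul_assoc, hcb, ← mul_assoc, mul_assoc y, ← pow_succ', hy0, zero_mul]
              | zero => rw [mul_zero, zero_mul]
              | add y z _ _ h₁ h₂ => rw [mul_add, add_mul, h₁, h₂, zero_add]
              | smul c y _ h₁ => rw [mul_smul_comm, smul_mul_assoc, h₁, smul_zero]
            · have hy0 := ih y hy
              have e1 : k - m = 0 := by omega
              rw [e1, pow_zero, mul_one] at hy0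
              rw [hy0, zero_mul, zero_mul]
          exact key z hz
    have hI0 := h I hIS (fun a ha y hy => ⟨hI a ha y hy, by
      rw [hS y (hIS hy) a ha]; exact hI a ha y hy⟩) ⟨k, by
        rw [Submodule.zero_eq_bot, eq_bot_iff]
        intro y hy
        simpa using hpow k y hy⟩
    have : x ∈ I := Submodule.subset_span (Or.inl rfl)
    rw [hI0] at this
    exact this
  · rintro h I hIS - ⟨k, hk⟩
    rw [eq_bot_iff]
    intro x hx
    refine h x (hIS hx) ⟨k, ?_⟩
    have := Submodule.pow_mem_pow I hx k
    rw [hk] at this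
    exact this

/-- A commutative self-adjoint algebra of matrices has no nonzero nilpotent elements. -/
theorem IsSelfAdjointAlgebra.eq_zero_of_isNilpotent
    {S : NonUnitalSubalgebra ℂ (Matrix (Fin n) (Fin n) ℂ)} (hc : IsCommutativeAlgebra S)
    (hS : IsSelfAdjointAlgebra S) {x : Matrix (Fin n) (Fin n) ℂ} (hx : x ∈ S)
    (h : IsNilpotent x) : x = 0 := by
  have key : ∀ k : ℕ, ∀ y : Matrix (Fin n) (Fin n) ℂ, yᴴ = y → y ^ (2 ^ k) = 0 → y = 0 := by
    intro k
    induction k with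
    | zero => intro y _ h; simpa using h
    | succ k ih =>
      intro y hy h
      have h2 : y * y = 0 := by
        refine ih (y * y) (by rw [Matrix.conjTranspose_mul, hy]) ?_
        rw [← pow_two, ← pow_mul, ← pow_succ', h]
      refine Matrix.conjTranspose_mul_self_eq_zero.1 ?_
      rw [hy, h2]
  obtain ⟨k, hk⟩ := h
  -- Since `x` is normal, the self-adjoint matrix `xᴴ * x` is nilpotent too, and repeated halving of
  -- the exponent in `key` kills it.
  refine Matrix.conjTranspose_mul_self_eq_zero.1 (key k _ (by simp) ?_)
  have hcx : Commute xᴴ x := hc _ (hS x hx) _ hx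
  rw [hcx.mul_pow, pow_eq_zero_of_le Nat.lt_two_pow_self.le hk, mul_zero]

/-- An idempotent in a commutative self-adjoint algebra of matrices is self-adjoint. -/
theorem IsSelfAdjointAlgebra.conjTranspose_eq_of_idempotent
    {S : NonUnitalSubalgebra ℂ (Matrix (Fin n) (Fin n) ℂ)} (hc : IsCommutativeAlgebra S)
    (hS : IsSelfAdjointAlgebra S) {e : Matrix (Fin n) (Fin n) ℂ} (he : e ∈ S)
    (h : e * e = e) : eᴴ = e := by
  have hcomm := hc e he eᴴ (hS e he)
  have h' : eᴴ * eᴴ = eᴴ := by rw [← Matrix.conjTranspose_mul, h]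
  have h1 : (e - e * eᴴ) * (e - e * eᴴ)ᴴ = 0 := by
    simp only [Matrix.conjTranspose_sub, Matrix.conjTranspose_mul,
      Matrix.conjTranspose_conjTranspose, sub_mul, mul_sub]
    have e1 : e * eᴴ * eᴴ = e * eᴴ := by rw [mul_assoc, h']
    have e2 : e * eᴴ * (e * eᴴ) = e * eᴴ := by
      rw [mul_assoc, ← mul_assoc eᴴ e, ← hcomm, mul_assoc e eᴴ, h', ← mul_assoc, h]
    rw [e1, e2, ← mul_assoc, h]
    simp
  have h2 : e = e * eᴴ := sub_eq_zero.1 (Matrix.self_mul_conjTranspose_eq_zero.1 h1)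
  rw [h2, Matrix.conjTranspose_mul, Matrix.conjTranspose_conjTranspose]

end Algebras

/-! ### Invariant complements, equivariant projections, common kernels. -/

section Equivariant

variable {n : ℕ} {G : Subgroup (GL (Fin n) ℂ)}

theorem IsInvariantSubspace.inf {U W : Submodule ℂ (Fin n → ℂ)} (hU : IsInvariantSubspace G U)
    (hW : IsInvariantSubspace G W) : IsInvariantSubspace G (U ⊓ W) :=
  fun g hg v hv => ⟨hU g hg v hv.1, hW g hg v hv.2⟩

theorem IsInvariantSubspace.sup {U W : Submodule ℂ (Fin n → ℂ)} (hU : IsInvariantSubspace G U)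
    (hW : IsInvariantSubspace G W) : IsInvariantSubspace G (U ⊔ W) := by
  intro g hg v hv
  obtain ⟨u, hu, w, hw, rfl⟩ := Submodule.mem_sup.1 hv
  rw [Matrix.mulVec_add]
  exact Submodule.add_mem_sup (hU g hg u hu) (hW g hg w hw)

/-- An invariant subspace of a completely reducible group has an invariant complement. -/
theorem IsCompletelyReducible.exists_isCompl (hG : IsCompletelyReducible G)
    {U : Submodule ℂ (Fin n → ℂ)} (hU : IsInvariantSubspace G U) :
    ∃ W, IsInvariantSubspace G W ∧ IsCompl U W := by
  obtain ⟨r, V, hV, hirr⟩ := hG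
  have hbot : IsInvariantSubspace G (⊥ : Submodule ℂ (Fin n → ℂ)) := by
    intro g _ v hv
    rw [Submodule.mem_bot] at hv ⊢
    rw [hv, Matrix.mulVec_zero]
  obtain ⟨W, ⟨hW, hd⟩, hmax⟩ := WellFounded.has_min (wellFounded_gt (α := Submodule ℂ (Fin n → ℂ)))
    {W | IsInvariantSubspace G W ∧ Disjoint U W} ⟨⊥, hbot, disjoint_bot_right⟩
  refine ⟨W, hW, hd, codisjoint_iff.2 (eq_top_iff.2 ?_)⟩
  rw [← hV.submodule_iSup_eq_top]
  -- `V i` meets `U ⊔ W` in zero or lies in it. In the first case `W ⊔ V i` is still disjoint from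
  -- `U`, against the maximality of `W`.
  refine iSup_le fun i => ?_
  rcases (hirr i).2.2 _ inf_le_left ((hirr i).2.1.inf (hU.sup hW)) with h | h
  · exfalso
    have hd' : Disjoint U (W ⊔ V i) := by
      refine Disjoint.disjoint_sup_right_of_disjoint_sup_left hd ?_
      exact (disjoint_iff.2 h).symm
    have hle : ¬ W < W ⊔ V i := fun hlt => hmax _ ⟨hW.sup (hirr i).2.1, hd'⟩ hlt
    have hVW : V i ≤ W := by
      by_contra hc
      exact hle (lt_of_le_of_ne le_sup_left fun he => hc (he ▸ le_sup_right))
    refine (hirr i).1 ?_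
    rw [← h]
    exact (inf_eq_left.2 (hVW.trans le_sup_right)).symm
  · exact inf_eq_left.1 h

/-- An invariant subspace of a completely reducible group is the image of an equivariant
projection. -/
theorem IsCompletelyReducible.exists_projection (hG : IsCompletelyReducible G)
    {U : Submodule ℂ (Fin n → ℂ)} (hU : IsInvariantSubspace G U) :
    ∃ P : Matrix (Fin n) (Fin n) ℂ, (∀ v, P *ᵥ v ∈ U) ∧ (∀ v ∈ U, P *ᵥ v = v) ∧
      ∀ g ∈ G, (g : Matrix (Fin n) (Fin n) ℂ) * P = P * (g : Matrix (Fin n) (Fin n) ℂ) := by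
  obtain ⟨W, hW, hc⟩ := hG.exists_isCompl hU
  have hP : ∀ v, LinearMap.toMatrix' (U.projection W hc) *ᵥ v = U.projection W hc v := by
    intro v
    rw [← Matrix.toLin'_apply, Matrix.toLin'_toMatrix']
  refine ⟨LinearMap.toMatrix' (U.projection W hc), fun v => ?_, fun v hv => ?_, fun g hg => ?_⟩
  · rw [hP]
    exact Submodule.projection_apply_mem hc v
  · rw [hP]
    exact Submodule.projection_apply_of_mem_left hc hv
  · refine Matrix.toLin'.injective (LinearMap.ext fun v => ?_)
    rw [Matrix.toLin'_apply, Matrix.toLin'_apply, ← Matrix.mulVec_mulVec, ← Matrix.mulVec_mulVec,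
      hP, hP]
    have hv : v ∈ U ⊔ W := by rw [hc.sup_eq_top]; trivial
    obtain ⟨u, hu, w, hw, rfl⟩ := Submodule.mem_sup.1 hv
    rw [Matrix.mulVec_add, map_add, map_add, Submodule.projection_apply_of_mem_left hc hu,
      (Submodule.projection_apply_eq_zero_iff hc).2 hw,
      Submodule.projection_apply_of_mem_left hc (hU g hg u hu),
      (Submodule.projection_apply_eq_zero_iff hc).2 (hW g hg w hw), add_zero, add_zero]

/-- Let `e` be an idempotent which is orthogonal to those of its conjugates under `G` that are
different from it. A subspace of the range of `e` that is invariant under the stabilizer of `e`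
is the image of a projection that is equivariant under this stabilizer. -/
theorem IsCompletelyReducible.exists_projection_of_stabilizer (hG : IsCompletelyReducible G)
    {e : Matrix (Fin n) (Fin n) ℂ} (he : e * e = e)
    (horth : ∀ g ∈ G, ¬ Commute (g : Matrix (Fin n) (Fin n) ℂ) e →
      e * (g : Matrix (Fin n) (Fin n) ℂ) * e = 0)
    {W : Submodule ℂ (Fin n → ℂ)} (hWe : ∀ v ∈ W, e *ᵥ v = v)
    (hW : ∀ g ∈ G, Commute (g : Matrix (Fin n) (Fin n) ℂ) e → ∀ v ∈ W,
      (g : Matrix (Fin n) (Fin n) ℂ) *ᵥ v ∈ W) :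
    ∃ p : Matrix (Fin n) (Fin n) ℂ, e * p = p ∧ p * e = p ∧ (∀ v, p *ᵥ v ∈ W) ∧
      (∀ v ∈ W, p *ᵥ v = v) ∧
      ∀ g ∈ G, Commute (g : Matrix (Fin n) (Fin n) ℂ) e →
        Commute (g : Matrix (Fin n) (Fin n) ℂ) p := by
  -- The translates of `W` span a `G`-invariant subspace, which `e` maps back into `W`: a translate
  -- by a stabilizing element is `W` itself, and any other is killed by `e`. Compressing an
  -- equivariant projection onto this span by `e` gives `p`.
  let s : Set (Fin n → ℂ) :=
    {v | ∃ g ∈ G, ∃ w ∈ W, v = (g : Matrix (Fin n) (Fin n) ℂ) *ᵥ w}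
  have hU : IsInvariantSubspace G (Submodule.span ℂ s) := by
    intro g hg v hv
    induction hv using Submodule.span_induction with
    | mem v hv =>
      obtain ⟨h, hh, w, hw, rfl⟩ := hv
      refine Submodule.subset_span ⟨g * h, G.mul_mem hg hh, w, hw, ?_⟩
      rw [Matrix.mulVec_mulVec, Units.val_mul]
    | zero => rw [Matrix.mulVec_zero]; exact Submodule.zero_mem _
    | add x y _ _ h₁ h₂ => rw [Matrix.mulVec_add]; exact Submodule.add_mem _ h₁ h₂
    | smul c x _ h₁ => rw [Matrix.mulVec_smul]; exact Submodule.smul_mem _ c h₁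
  have hWU : W ≤ Submodule.span ℂ s := fun w hw =>
    Submodule.subset_span ⟨1, G.one_mem, w, hw, by rw [Units.val_one, Matrix.one_mulVec]⟩
  have hUW : ∀ v ∈ Submodule.span ℂ s, e *ᵥ v ∈ W := by
    intro v hv
    induction hv using Submodule.span_induction with
    | mem v hv =>
      obtain ⟨g, hg, w, hw, rfl⟩ := hv
      by_cases hge : Commute (g : Matrix (Fin n) (Fin n) ℂ) e
      · have := hW g hg hge w hw
        rwa [hWe _ this]
      · rw [← hWe w hw, Matrix.mulVec_mulVec, Matrix.mulVec_mulVec, horth g hg hge,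
          Matrix.zero_mulVec]
        exact W.zero_mem
    | zero => rw [Matrix.mulVec_zero]; exact Submodule.zero_mem _
    | add x y _ _ h₁ h₂ => rw [Matrix.mulVec_add]; exact Submodule.add_mem _ h₁ h₂
    | smul c x _ h₁ => rw [Matrix.mulVec_smul]; exact Submodule.smul_mem _ c h₁
  obtain ⟨P, hP₁, hP₂, hP₃⟩ := hG.exists_projection hU
  refine ⟨e * P * e, ?_, ?_, fun v => ?_, fun v hv => ?_, fun g hg hge => ?_⟩
  · rw [← mul_assoc, ← mul_assoc, he]
  · rw [mul_assoc, he]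
  · rw [← Matrix.mulVec_mulVec, ← Matrix.mulVec_mulVec]
    exact hUW _ (hP₁ _)
  · rw [← Matrix.mulVec_mulVec, ← Matrix.mulVec_mulVec, hWe v hv, hP₂ v (hWU hv), hWe v hv]
  · exact (hge.mul_right (hP₃ g hg)).mul_right hge

/-- Commuting nilpotent matrices that leave a nonzero subspace invariant have a common nonzero
kernel vector in it. -/
theorem exists_common_kernel_vector {J : Set (Matrix (Fin n) (Fin n) ℂ)}
    (hc : ∀ x ∈ J, ∀ y ∈ J, Commute x y) (hn : ∀ x ∈ J, IsNilpotent x)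
    {R : Submodule ℂ (Fin n → ℂ)} (hR : R ≠ ⊥) (hJR : ∀ x ∈ J, ∀ v ∈ R, x *ᵥ v ∈ R) :
    ∃ v ∈ R, v ≠ 0 ∧ ∀ x ∈ J, x *ᵥ v = 0 := by
  -- On a minimal nonzero `J`-invariant subspace every `x ∈ J` vanishes: its kernel there is
  -- invariant by commutativity and nonzero by nilpotence.
  obtain ⟨W, ⟨hWR, hW0, hJW⟩, hmin⟩ :=
    WellFounded.has_min (wellFounded_lt (α := Submodule ℂ (Fin n → ℂ)))
    {W | W ≤ R ∧ W ≠ ⊥ ∧ ∀ x ∈ J, ∀ v ∈ W, x *ᵥ v ∈ W} ⟨R, le_rfl, hR, hJR⟩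
  obtain ⟨v, hv, hv0⟩ := Submodule.exists_mem_ne_zero_of_ne_bot hW0
  refine ⟨v, hWR hv, hv0, fun x hx => ?_⟩
  have hle : W ⊓ LinearMap.ker (Matrix.toLin' x) ≤ W := inf_le_left
  have hK : W ⊓ LinearMap.ker (Matrix.toLin' x) = W := by
    by_contra hne
    refine hmin _ ⟨hle.trans hWR, ?_, fun y hy w hw => ⟨hJW y hy w hw.1, ?_⟩⟩ (lt_of_le_of_ne hle hne)
    · intro hbot
      obtain ⟨k, hk⟩ := hn x hx
      have hmem : ∀ m : ℕ, (x ^ m) *ᵥ v ∈ W ∧ (x ^ m) *ᵥ v ≠ 0 := by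
        intro m
        induction m with
        | zero => rw [pow_zero, Matrix.one_mulVec]; exact ⟨hv, hv0⟩
        | succ m ih =>
          rw [pow_succ', ← Matrix.mulVec_mulVec]
          refine ⟨hJW x hx _ ih.1, fun h0 => ih.2 ?_⟩
          have : (x ^ m) *ᵥ v ∈ W ⊓ LinearMap.ker (Matrix.toLin' x) :=
            ⟨ih.1, by rw [SetLike.mem_coe, LinearMap.mem_ker, Matrix.toLin'_apply, h0]⟩
          rwa [hbot] at this
      exact (hmem k).2 (by rw [hk, Matrix.zero_mulVec])
    · have hw' := hw.2
      rw [SetLike.mem_coe, LinearMap.mem_ker, Matrix.toLin'_apply] at hw' ⊢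
      rw [Matrix.mulVec_mulVec, (hc x hx y hy).eq, ← Matrix.mulVec_mulVec, hw', Matrix.mulVec_zero]
  have hvK : v ∈ W ⊓ LinearMap.ker (Matrix.toLin' x) := by rw [hK]; exact hv
  have := hvK.2
  rwa [SetLike.mem_coe, LinearMap.mem_ker, Matrix.toLin'_apply] at this

end Equivariant

/-! ### The stabilizer of an idempotent acting on its range. -/

section Stabilizer

variable {n : ℕ}

/-- The vectors fixed by a matrix. -/
def fixedSpace (e : Matrix (Fin n) (Fin n) ℂ) : Submodule ℂ (Fin n → ℂ) where
  carrier := {v | e *ᵥ v = v}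
  add_mem' {u v} hu hv := by
    change e *ᵥ (u + v) = u + v
    rw [Matrix.mulVec_add, show e *ᵥ u = u from hu, show e *ᵥ v = v from hv]
  zero_mem' := Matrix.mulVec_zero e
  smul_mem' c v hv := by
    change e *ᵥ (c • v) = c • v
    rw [Matrix.mulVec_smul, show e *ᵥ v = v from hv]

theorem mem_fixedSpace {e : Matrix (Fin n) (Fin n) ℂ} {v : Fin n → ℂ} :
    v ∈ fixedSpace e ↔ e *ᵥ v = v := Iff.rfl

theorem mulVec_mem_fixedSpace {e m : Matrix (Fin n) (Fin n) ℂ} (h : e * m = m) (v : Fin n → ℂ) :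
    m *ᵥ v ∈ fixedSpace e := by
  rw [mem_fixedSpace, Matrix.mulVec_mulVec, h]

theorem fixedSpace_ne_bot {e : Matrix (Fin n) (Fin n) ℂ} (he : e * e = e) (h0 : e ≠ 0) :
    fixedSpace e ≠ ⊥ := by
  intro h
  refine h0 (Matrix.toLin'.injective (LinearMap.ext fun v => ?_))
  have := mulVec_mem_fixedSpace he v
  rw [h, Submodule.mem_bot] at this
  rw [Matrix.toLin'_apply, this, map_zero, LinearMap.zero_apply]

/-- The subgroup of the elements of `G` that commute with the matrix `e`. -/
def commutingSubgroup (G : Subgroup (GL (Fin n) ℂ)) (e : Matrix (Fin n) (Fin n) ℂ) :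
    Subgroup G where
  carrier := {g | Commute ((g : GL (Fin n) ℂ) : Matrix (Fin n) (Fin n) ℂ) e}
  mul_mem' {g h} hg hh := by
    change Commute ((g * h : GL (Fin n) ℂ) : Matrix (Fin n) (Fin n) ℂ) e
    rw [Units.val_mul]
    exact Commute.mul_left hg hh
  one_mem' := Commute.one_left e
  inv_mem' {g} hg := Commute.units_inv_left hg

/-- The inclusion of `commutingSubgroup G e` into the matrices. -/
def commutingSubgroup.val (G : Subgroup (GL (Fin n) ℂ)) (e : Matrix (Fin n) (Fin n) ℂ) :
    commutingSubgroup G e →* Matrix (Fin n) (Fin n) ℂ :=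
  (Units.coeHom _).comp (G.subtype.comp (commutingSubgroup G e).subtype)

variable {G : Subgroup (GL (Fin n) ℂ)} {e : Matrix (Fin n) (Fin n) ℂ}

theorem commutingSubgroup.commute_val (h : commutingSubgroup G e) :
    Commute (commutingSubgroup.val G e h) e := h.2

theorem commutingSubgroup.val_mul_inv (h : commutingSubgroup G e) :
    commutingSubgroup.val G e h * commutingSubgroup.val G e h⁻¹ = 1 := by
  rw [← map_mul, mul_inv_cancel, map_one]

theorem commutingSubgroup.val_inv_mul (h : commutingSubgroup G e) :
    commutingSubgroup.val G e h⁻¹ * commutingSubgroup.val G e h = 1 := by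
  rw [← map_mul, inv_mul_cancel, map_one]

/-- The elements of `commutingSubgroup G e` that act trivially on the range of `e`. -/
def rangeFixingSubgroup (G : Subgroup (GL (Fin n) ℂ)) (e : Matrix (Fin n) (Fin n) ℂ) :
    Subgroup (commutingSubgroup G e) where
  carrier := {h | commutingSubgroup.val G e h * e = e}
  mul_mem' {g h} hg hh := by
    change _ * e = e
    rw [map_mul, mul_assoc, show commutingSubgroup.val G e h * e = e from hh]
    exact hg
  one_mem' := by
    change _ * e = e
    rw [map_one, one_mul]
  inv_mem' {g} hg := by
    change _ * e = e
    have := congrArg (commutingSubgroup.val G e g⁻¹ * ·) hg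
    simp only [← mul_assoc, commutingSubgroup.val_inv_mul, one_mul] at this
    exact this.symm

theorem mem_rangeFixingSubgroup {h : commutingSubgroup G e} :
    h ∈ rangeFixingSubgroup G e ↔ commutingSubgroup.val G e h * e = e := Iff.rfl

instance rangeFixingSubgroup_normal : (rangeFixingSubgroup G e).Normal where
  conj_mem k hk h := by
    rw [mem_rangeFixingSubgroup] at hk ⊢
    rw [map_mul, map_mul, mul_assoc, (commutingSubgroup.commute_val h⁻¹).eq, ← mul_assoc,
      mul_assoc _ _ e, hk, mul_assoc, ← (commutingSubgroup.commute_val h⁻¹).eq, ← mul_assoc,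
      commutingSubgroup.val_mul_inv, one_mul]

/-- This identifies the quotient with the group of matrices `h * e`, that is, with the image of the
stabilizer acting on the range of `e`. -/
theorem quotient_rangeFixingSubgroup_eq {h k : commutingSubgroup G e} :
    (h : commutingSubgroup G e ⧸ rangeFixingSubgroup G e) = k ↔
      commutingSubgroup.val G e h * e = commutingSubgroup.val G e k * e := by
  rw [QuotientGroup.eq, mem_rangeFixingSubgroup, map_mul, mul_assoc]
  constructor
  · intro hh
    have := congrArg (commutingSubgroup.val G e h * ·) hh
    simp only [← mul_assoc, commutingSubgroup.val_mul_inv, one_mul] at this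
    exact this.symm
  · intro hh
    rw [← hh, ← mul_assoc, commutingSubgroup.val_inv_mul, one_mul]

/-- Schur's lemma for the action of `commutingSubgroup G e` on the range of `e`. -/
theorem exists_eq_smul_of_commute (he : e * e = e) (h0 : e ≠ 0)
    (hirr : ∀ W ≤ fixedSpace e, (∀ h, ∀ v ∈ W, commutingSubgroup.val G e h *ᵥ v ∈ W) →
      W = ⊥ ∨ W = fixedSpace e)
    {m : Matrix (Fin n) (Fin n) ℂ} (hem : e * m = m) (hme : m * e = m)
    (hm : ∀ h, Commute (commutingSubgroup.val G e h) m) : ∃ c : ℂ, m = c • e := by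
  have hmap : ∀ v ∈ fixedSpace e, Matrix.toLin' m v ∈ fixedSpace e := fun v _ => by
    rw [Matrix.toLin'_apply]; exact mulVec_mem_fixedSpace hem v
  have : Nontrivial (fixedSpace e) :=
    Submodule.nontrivial_iff_ne_bot.2 (fixedSpace_ne_bot he h0)
  obtain ⟨c, hc⟩ := Module.End.exists_eigenvalue ((Matrix.toLin' m).restrict hmap)
  obtain ⟨v, hv⟩ := hc.exists_hasEigenvector
  have hv' : m *ᵥ (v : Fin n → ℂ) = c • (v : Fin n → ℂ) := by
    have := congrArg Subtype.val hv.apply_eq_smul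
    rwa [LinearMap.coe_restrict_apply, Matrix.toLin'_apply] at this
  -- An eigenspace of `m` inside the range of `e`; it is invariant and nonzero, hence the whole
  -- range.
  let W : Submodule ℂ (Fin n → ℂ) := fixedSpace e ⊓ LinearMap.ker (Matrix.toLin' m - c • 1)
  have hW : ∀ w, w ∈ W ↔ e *ᵥ w = w ∧ m *ᵥ w = c • w := fun w => by
    change _ ∧ _ ↔ _
    rw [SetLike.mem_coe, SetLike.mem_coe, mem_fixedSpace, LinearMap.mem_ker, LinearMap.sub_apply, sub_eq_zero,
      Matrix.toLin'_apply]
    rfl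
  have hWinv : ∀ h, ∀ w ∈ W, commutingSubgroup.val G e h *ᵥ w ∈ W := by
    intro h w hw
    rw [hW] at hw ⊢
    rw [Matrix.mulVec_mulVec, Matrix.mulVec_mulVec, ← (hm h).eq,
      ← (commutingSubgroup.commute_val h).eq, ← Matrix.mulVec_mulVec, ← Matrix.mulVec_mulVec,
      hw.1, hw.2, Matrix.mulVec_smul]
    exact ⟨rfl, rfl⟩
  refine ⟨c, Matrix.toLin'.injective (LinearMap.ext fun u => ?_)⟩
  rcases hirr W inf_le_left hWinv with h | h
  · exfalso
    have hvW : (v : Fin n → ℂ) ∈ W := (hW _).2 ⟨v.2, hv'⟩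
    rw [h, Submodule.mem_bot] at hvW
    exact hv.2 (Subtype.ext hvW)
  · have hu : e *ᵥ u ∈ W := by rw [h]; exact mulVec_mem_fixedSpace he u
    have := ((hW _).1 hu).2
    rw [Matrix.mulVec_mulVec, hme] at this
    rw [Matrix.toLin'_apply, this, Matrix.toLin'_apply, Matrix.smul_mulVec]

end Stabilizer

/-! ### Non-scalar invariant commuting sets on the range of an idempotent. -/

section Refinement

variable {n : ℕ}

/-- `C` is a commuting set of semisimple matrices supported by the idempotent `e`, it is invariant
under the stabilizer of `e` in `G`, and not all its elements are multiples of `e`. -/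
structure Refines (G : Subgroup (GL (Fin n) ℂ)) (e : Matrix (Fin n) (Fin n) ℂ)
    (C : Set (Matrix (Fin n) (Fin n) ℂ)) : Prop where
  commute : ∀ a ∈ C, ∀ b ∈ C, a * b = b * a
  isSemisimple : ∀ a ∈ C, IsSemisimpleMatrix a
  left_mul : ∀ a ∈ C, e * a = a
  right_mul : ∀ a ∈ C, a * e = a
  conj_mem : ∀ h : commutingSubgroup G e, ∀ a ∈ C,
    commutingSubgroup.val G e h * a * commutingSubgroup.val G e h⁻¹ ∈ C
  exists_ne : ∃ a ∈ C, ∀ c : ℂ, a ≠ c • e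

variable {G : Subgroup (GL (Fin n) ℂ)} {e : Matrix (Fin n) (Fin n) ℂ}

theorem commutingSubgroup.conj_eq_of_commute {h : commutingSubgroup G e}
    {a : Matrix (Fin n) (Fin n) ℂ} (ha : Commute (commutingSubgroup.val G e h) a) :
    commutingSubgroup.val G e h * a * commutingSubgroup.val G e h⁻¹ = a := by
  rw [ha.eq, mul_assoc, val_mul_inv, mul_one]

theorem Refines.singleton {a : Matrix (Fin n) (Fin n) ℂ} (hs : IsSemisimpleMatrix a)
    (hl : e * a = a) (hr : a * e = a)
    (hc : ∀ h, Commute (commutingSubgroup.val G e h) a) (hne : ∀ c : ℂ, a ≠ c • e) :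
    Refines G e {a} where
  commute := by rintro _ rfl _ rfl; rfl
  isSemisimple := by rintro _ rfl; exact hs
  left_mul := by rintro _ rfl; exact hl
  right_mul := by rintro _ rfl; exact hr
  conj_mem := by rintro h _ rfl; exact commutingSubgroup.conj_eq_of_commute (hc h)
  exists_ne := ⟨a, rfl, hne⟩

/-- The algebra generated by `a` is commutative and self-adjoint, hence reduced. -/
theorem isSemisimpleMatrix_of_conjTranspose_eq {a : Matrix (Fin n) (Fin n) ℂ} (ha : aᴴ = a) :
    IsSemisimpleMatrix a := by
  have hc : IsCommutativeAlgebra (NonUnitalAlgebra.adjoin ℂ {a}) := by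
    have := NonUnitalAlgebra.isMulCommutative_adjoin ℂ (s := {a}) (by rintro _ rfl _ rfl; rfl)
    intro x hx y hy
    exact setLike_mul_comm hx hy
  have hS : IsSelfAdjointAlgebra (NonUnitalAlgebra.adjoin ℂ {a}) := by
    intro x hx
    induction hx using NonUnitalAlgebra.adjoin_induction with
    | mem x hx =>
      rw [Set.mem_singleton_iff.1 hx, ha]
      exact NonUnitalAlgebra.subset_adjoin ℂ rfl
    | zero => rw [Matrix.conjTranspose_zero]; exact zero_mem _
    | add x y _ _ h₁ h₂ => rw [Matrix.conjTranspose_add]; exact add_mem h₁ h₂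
    | mul x y _ _ h₁ h₂ => rw [Matrix.conjTranspose_mul]; exact mul_mem h₂ h₁
    | smul c x _ h₁ => rw [Matrix.conjTranspose_smul]; exact SMulMemClass.smul_mem _ h₁
  exact isSemisimpleMatrix_of_reduced (fun x hx hn => hS.eq_zero_of_isNilpotent hc hx hn)
    (NonUnitalAlgebra.subset_adjoin ℂ rfl)

theorem IsUnitaryMatrixGroup.conjTranspose_val (hG : IsUnitaryMatrixGroup G)
    (h : commutingSubgroup G e) :
    (commutingSubgroup.val G e h)ᴴ = commutingSubgroup.val G e h⁻¹ := by
  have h1 : (commutingSubgroup.val G e h)ᴴ * commutingSubgroup.val G e h = 1 :=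
    (Matrix.mem_unitaryGroup_iff'.1 (hG _ h.1.2))
  rw [← mul_one (_ᴴ), ← commutingSubgroup.val_mul_inv h, ← mul_assoc, h1, one_mul]

open scoped ComplexOrder in
/-- Refinement if the stabilizer of `e` acts reducibly on the range of `e`. -/
theorem exists_refines_of_reducible (hG : IsCompletelyReducible G) (he : e * e = e)
    (horth : ∀ g ∈ G, ¬ Commute (g : Matrix (Fin n) (Fin n) ℂ) e →
      e * (g : Matrix (Fin n) (Fin n) ℂ) * e = 0)
    {W : Submodule ℂ (Fin n → ℂ)} (hWe : W ≤ fixedSpace e)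
    (hW : ∀ h, ∀ v ∈ W, commutingSubgroup.val G e h *ᵥ v ∈ W) (hW₀ : W ≠ ⊥)
    (hW₁ : W ≠ fixedSpace e) :
    ∃ C, Refines G e C ∧ (IsUnitaryMatrixGroup G → eᴴ = e → ∀ a ∈ C, aᴴ ∈ C) := by
  obtain ⟨p, hep, hpe, hp₁, hp₂, hp₃⟩ := hG.exists_projection_of_stabilizer he horth hWe
    (fun g hg hge v hv => hW ⟨⟨g, hg⟩, hge⟩ v hv)
  have hcomm : ∀ h, Commute (commutingSubgroup.val G e h) p := fun h => hp₃ _ h.1.2 h.2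
  have hpp : p * p = p := by
    refine Matrix.toLin'.injective (LinearMap.ext fun v => ?_)
    rw [Matrix.toLin'_apply, ← Matrix.mulVec_mulVec, hp₂ _ (hp₁ v), Matrix.toLin'_apply]
  have hp0 : p ≠ 0 := by
    rintro rfl
    refine hW₀ (eq_bot_iff.2 fun v hv => ?_)
    rw [← hp₂ v hv, Matrix.zero_mulVec]
    exact Submodule.zero_mem _
  have hpne : p ≠ e := by
    rintro rfl
    exact hW₁ (le_antisymm hWe fun v hv => by rw [← mem_fixedSpace.1 hv]; exact hp₁ v)
  -- The projection `p` need not be orthogonal, so in the unitary case it is replaced by `p * pᴴ`,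
  -- which still commutes with the stabilizer because adjoints of its elements are their inverses.
  by_cases hu : IsUnitaryMatrixGroup G ∧ eᴴ = e
  · obtain ⟨hu, hes⟩ := hu
    refine ⟨{p * pᴴ}, Refines.singleton (isSemisimpleMatrix_of_conjTranspose_eq (by simp)) ?_ ?_
      (fun h => (hcomm h).mul_right ?_) fun c hc => ?_, ?_⟩
    · rw [← mul_assoc, hep]
    · have h1 : pᴴ * e = pᴴ := by
        nth_rw 1 [← hes]
        rw [← Matrix.conjTranspose_mul, hep]
      rw [mul_assoc, h1]
    · have h1 := hcomm h⁻¹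
      have h2 := congrArg Matrix.conjTranspose h1.eq
      rw [Matrix.conjTranspose_mul, Matrix.conjTranspose_mul, hu.conjTranspose_val, inv_inv] at h2
      exact h2.symm
    · have h1 : c • e = c • p := by
        have : p * (p * pᴴ) = p * pᴴ := by rw [← mul_assoc, hpp]
        rw [hc, mul_smul_comm, hpe] at this
        exact this.symm
      rcases eq_or_ne c 0 with rfl | hc0
      · rw [zero_smul] at hc
        exact hp0 (Matrix.self_mul_conjTranspose_eq_zero.1 hc)
      · exact hpne (smul_right_injective _ hc0 h1).symm
    · rintro - - _ rfl
      rw [Set.mem_singleton_iff]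
      simp
  · refine ⟨{p}, Refines.singleton (isSemisimpleMatrix_of_isIdempotentElem hpp) hep hpe hcomm
      fun c hc => ?_, fun h₁ h₂ => absurd ⟨h₁, h₂⟩ hu⟩
    have h1 : c • p = p := by
      have := hpp
      nth_rw 1 [hc] at this
      rwa [smul_mul_assoc, hep] at this
    have h2 : c = 1 := by
      by_contra hne
      have : (c - 1) • p = 0 := by rw [sub_smul, h1, one_smul, sub_self]
      exact (smul_eq_zero.1 this).elim (fun h => hne (sub_eq_zero.1 h)) hp0
    exact hpne (by rw [hc, h2, one_smul])

/-- Refinement if the stabilizer of `e` acts irreducibly on the range of `e`. -/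
theorem exists_refines_of_irreducible (hsub : SubquotientsHaveNoncentralAbelianNormal G)
    (he : e * e = e) {x : Matrix (Fin n) (Fin n) ℂ} (hx : Commute x e)
    (hxe : ∀ c : ℂ, x * e ≠ c • e)
    (hirr : ∀ W ≤ fixedSpace e, (∀ h, ∀ v ∈ W, commutingSubgroup.val G e h *ᵥ v ∈ W) →
      W = ⊥ ∨ W = fixedSpace e) :
    ∃ C, Refines G e C ∧ (IsUnitaryMatrixGroup G → eᴴ = e → ∀ a ∈ C, aᴴ ∈ C) := by
  have h0 : e ≠ 0 := by
    rintro rfl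
    exact hxe 0 (by simp)
  have hschur : ∀ m : Matrix (Fin n) (Fin n) ℂ, e * m = m → m * e = m →
      (∀ h, Commute (commutingSubgroup.val G e h) m) → ∃ c : ℂ, m = c • e :=
    fun m h₁ h₂ h₃ => exists_eq_smul_of_commute he h0 hirr h₁ h₂ h₃
  have hle : ∀ h : commutingSubgroup G e, e * (commutingSubgroup.val G e h * e) =
      commutingSubgroup.val G e h * e := fun h => by
    rw [← mul_assoc, ← (commutingSubgroup.commute_val h).eq, mul_assoc, he]
  have hre : ∀ m : Matrix (Fin n) (Fin n) ℂ, m * e * e = m * e := fun m => by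
    rw [mul_assoc, he]
  have hmul : ∀ h k : commutingSubgroup G e, commutingSubgroup.val G e h * e *
      (commutingSubgroup.val G e k * e) = commutingSubgroup.val G e (h * k) * e := fun h k => by
    rw [mul_assoc, hle, ← mul_assoc, map_mul]
  -- If the image were abelian, Schur's lemma would make all its elements scalar on the range of
  -- `e`. Then `x * e` would commute with them and be scalar too.
  have hnab : ¬ ∀ a b : commutingSubgroup G e ⧸ rangeFixingSubgroup G e, a * b = b * a := by
    intro hab
    have hsc : ∀ h, ∃ c : ℂ, commutingSubgroup.val G e h * e = c • e := by
      intro h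
      refine hschur _ (hle h) (hre _) fun k => ?_
      have := hab k h
      rw [← QuotientGroup.mk_mul, ← QuotientGroup.mk_mul, quotient_rangeFixingSubgroup_eq, map_mul,
        map_mul] at this
      change _ * (_ * e) = (_ * e) * _
      rw [← mul_assoc, this, mul_assoc, (commutingSubgroup.commute_val k).eq, mul_assoc]
    obtain ⟨c, hc⟩ := hschur (x * e) (by rw [← mul_assoc, ← hx.eq, mul_assoc, he]) (hre x)
      fun h => by
        obtain ⟨c, hc⟩ := hsc h
        change _ * (_ * e) = (_ * e) * _
        rw [mul_assoc, ← (commutingSubgroup.commute_val h).eq, hc, hx.eq, ← mul_assoc, hc,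
          smul_mul_assoc, mul_smul_comm, hx.eq]
    exact hxe c hc
  obtain ⟨K, hKn, hKc, hKz⟩ := hsub _ (rangeFixingSubgroup G e) hnab
  let C : Set (Matrix (Fin n) (Fin n) ℂ) :=
    {a | ∃ h : commutingSubgroup G e, (h : commutingSubgroup G e ⧸ rangeFixingSubgroup G e) ∈ K ∧
      a = commutingSubgroup.val G e h * e}
  have hCc : ∀ a ∈ C, ∀ b ∈ C, a * b = b * a := by
    rintro _ ⟨h, hh, rfl⟩ _ ⟨k, hk, rfl⟩
    rw [hmul, hmul, ← quotient_rangeFixingSubgroup_eq, QuotientGroup.mk_mul, QuotientGroup.mk_mul,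
      hKc _ hh _ hk]
  have hconj : ∀ h : commutingSubgroup G e, ∀ a ∈ C,
      commutingSubgroup.val G e h * a * commutingSubgroup.val G e h⁻¹ ∈ C := by
    rintro h _ ⟨k, hk, rfl⟩
    refine ⟨h * k * h⁻¹, ?_, ?_⟩
    · rw [QuotientGroup.mk_mul, QuotientGroup.mk_mul, QuotientGroup.mk_inv]
      exact hKn.conj_mem _ hk _
    · rw [map_mul, map_mul, mul_assoc _ _ e, (commutingSubgroup.commute_val h⁻¹).eq]
      simp only [mul_assoc]
  -- If `C` were scalar, `K` would be central.
  have hne : ∃ a ∈ C, ∀ c : ℂ, a ≠ c • e := by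
    by_contra! hcon
    refine hKz fun q hq => ?_
    induction q using QuotientGroup.induction_on with
    | H k =>
      rw [Subgroup.mem_center_iff]
      intro r
      induction r using QuotientGroup.induction_on with
      | H h =>
        obtain ⟨c, hc⟩ := hcon _ ⟨k, hq, rfl⟩
        rw [← QuotientGroup.mk_mul, ← QuotientGroup.mk_mul, quotient_rangeFixingSubgroup_eq, ← hmul,
          ← hmul, hc, mul_smul_comm, smul_mul_assoc, hle, hre]
  have hDc : IsCommutativeAlgebra (NonUnitalAlgebra.adjoin ℂ C) := by
    have := NonUnitalAlgebra.isMulCommutative_adjoin ℂ hCc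
    intro x hx y hy
    exact setLike_mul_comm hx hy
  have hDe : ∀ d ∈ NonUnitalAlgebra.adjoin ℂ C, e * d = d ∧ d * e = d := by
    intro d hd
    induction hd using NonUnitalAlgebra.adjoin_induction with
    | mem d hd =>
      obtain ⟨h, -, rfl⟩ := hd
      exact ⟨hle h, hre _⟩
    | zero => simp
    | add x y _ _ h₁ h₂ => rw [mul_add, add_mul, h₁.1, h₁.2, h₂.1, h₂.2]; exact ⟨rfl, rfl⟩
    | mul x y _ _ h₁ h₂ => rw [← mul_assoc, h₁.1, mul_assoc, h₂.2]; exact ⟨rfl, rfl⟩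
    | smul c x _ h₁ => rw [mul_smul_comm, smul_mul_assoc, h₁.1, h₁.2]; exact ⟨rfl, rfl⟩
  have hDconj : ∀ h : commutingSubgroup G e, ∀ d ∈ NonUnitalAlgebra.adjoin ℂ C,
      commutingSubgroup.val G e h * d * commutingSubgroup.val G e h⁻¹ ∈
        NonUnitalAlgebra.adjoin ℂ C := by
    intro h d hd
    induction hd using NonUnitalAlgebra.adjoin_induction with
    | mem d hd => exact NonUnitalAlgebra.subset_adjoin ℂ (hconj h d hd)
    | zero => rw [mul_zero, zero_mul]; exact zero_mem _
    | add x y _ _ h₁ h₂ => rw [mul_add, add_mul]; exact add_mem h₁ h₂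
    | mul x y _ _ h₁ h₂ =>
      have := mul_mem h₁ h₂
      rwa [mul_assoc, ← mul_assoc (commutingSubgroup.val G e h⁻¹), ← mul_assoc
        (commutingSubgroup.val G e h⁻¹), commutingSubgroup.val_inv_mul, one_mul, ← mul_assoc,
        mul_assoc _ x y] at this
    | smul c x _ h₁ => rw [mul_smul_comm, smul_mul_assoc]; exact SMulMemClass.smul_mem _ h₁
  -- The common kernel `U` of the nilpotents of the algebra generated by `C` is nonzero in the range
  -- of `e`. It is invariant, as conjugation permutes these nilpotents, so by irreducibility it is
  -- the whole range.
  have hred : ∀ d ∈ NonUnitalAlgebra.adjoin ℂ C, IsNilpotent d → d = 0 := by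
    let U : Submodule ℂ (Fin n → ℂ) := fixedSpace e ⊓
      ⨅ d : {d // d ∈ NonUnitalAlgebra.adjoin ℂ C ∧ IsNilpotent d},
        LinearMap.ker (Matrix.toLin' d.1)
    have hU : ∀ v, v ∈ U ↔ e *ᵥ v = v ∧
        ∀ d ∈ NonUnitalAlgebra.adjoin ℂ C, IsNilpotent d → d *ᵥ v = 0 := by
      intro v
      rw [Submodule.mem_inf, mem_fixedSpace, Submodule.mem_iInf]
      simp only [LinearMap.mem_ker, Matrix.toLin'_apply, Subtype.forall, and_imp]
    obtain ⟨v, hv, hv0, hvd⟩ := exists_common_kernel_vector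
      (J := {d | d ∈ NonUnitalAlgebra.adjoin ℂ C ∧ IsNilpotent d})
      (fun a ha b hb => hDc a ha.1 b hb.1) (fun a ha => ha.2) (fixedSpace_ne_bot he h0)
      (fun a ha v _ => mulVec_mem_fixedSpace (hDe a ha.1).1 v)
    have hvU : v ∈ U := (hU v).2 ⟨hv, fun d hd hn => hvd d ⟨hd, hn⟩⟩
    have hUinv : ∀ h, ∀ v ∈ U, commutingSubgroup.val G e h *ᵥ v ∈ U := by
      intro h v hv
      rw [hU] at hv ⊢
      constructor
      · rw [Matrix.mulVec_mulVec, ← (commutingSubgroup.commute_val h).eq, ← Matrix.mulVec_mulVec,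
          hv.1]
      · intro d hd hn
        have h1 := hDconj h⁻¹ d hd
        rw [inv_inv] at h1
        have h2 : IsNilpotent (commutingSubgroup.val G e h⁻¹ * d * commutingSubgroup.val G e h) := by
          obtain ⟨k, hk⟩ := hn
          refine ⟨k, ?_⟩
          have h3 : ∀ m : ℕ, (commutingSubgroup.val G e h⁻¹ * d * commutingSubgroup.val G e h) ^ m =
              commutingSubgroup.val G e h⁻¹ * d ^ m * commutingSubgroup.val G e h := by
            intro m
            induction m with
            | zero => rw [pow_zero, pow_zero, mul_one, commutingSubgroup.val_inv_mul]
            | succ m ih =>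
              rw [pow_succ, ih, pow_succ]
              simp only [mul_assoc]
              rw [← mul_assoc (commutingSubgroup.val G e h) (commutingSubgroup.val G e h⁻¹),
                commutingSubgroup.val_mul_inv, one_mul]
          rw [h3, hk, mul_zero, zero_mul]
        have h4 := congrArg (commutingSubgroup.val G e h *ᵥ ·) (hv.2 _ h1 h2)
        simp only [Matrix.mulVec_mulVec, Matrix.mulVec_zero] at h4
        rwa [← mul_assoc, ← mul_assoc, commutingSubgroup.val_mul_inv, one_mul,
          ← Matrix.mulVec_mulVec] at h4
    intro d hd hn
    rcases hirr U inf_le_left hUinv with h | h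
    · rw [h, Submodule.mem_bot] at hvU
      exact absurd hvU hv0
    · refine Matrix.toLin'.injective (LinearMap.ext fun u => ?_)
      have hu : e *ᵥ u ∈ U := by rw [h]; exact mulVec_mem_fixedSpace he u
      have := ((hU _).1 hu).2 d hd hn
      rw [Matrix.mulVec_mulVec, (hDe d hd).2] at this
      rw [Matrix.toLin'_apply, this, map_zero, LinearMap.zero_apply]
  refine ⟨C, ⟨hCc, fun a ha => isSemisimpleMatrix_of_reduced hred
    (NonUnitalAlgebra.subset_adjoin ℂ ha), fun a ha => ?_, fun a ha => ?_, hconj, hne⟩, ?_⟩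
  · exact (hDe a (NonUnitalAlgebra.subset_adjoin ℂ ha)).1
  · exact (hDe a (NonUnitalAlgebra.subset_adjoin ℂ ha)).2
  · rintro hu hes _ ⟨h, hh, rfl⟩
    refine ⟨h⁻¹, ?_, ?_⟩
    · rw [QuotientGroup.mk_inv]
      exact K.inv_mem hh
    · rw [Matrix.conjTranspose_mul, hes, hu.conjTranspose_val,
        (commutingSubgroup.commute_val h⁻¹).eq]

theorem exists_refines (hG : IsCompletelyReducible G)
    (hsub : SubquotientsHaveNoncentralAbelianNormal G) (he : e * e = e)
    (horth : ∀ g ∈ G, ¬ Commute (g : Matrix (Fin n) (Fin n) ℂ) e →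
      e * (g : Matrix (Fin n) (Fin n) ℂ) * e = 0)
    {x : Matrix (Fin n) (Fin n) ℂ} (hx : Commute x e) (hxe : ∀ c : ℂ, x * e ≠ c • e) :
    ∃ C, Refines G e C ∧ (IsUnitaryMatrixGroup G → eᴴ = e → ∀ a ∈ C, aᴴ ∈ C) := by
  by_cases h : ∀ W ≤ fixedSpace e, (∀ h, ∀ v ∈ W, commutingSubgroup.val G e h *ᵥ v ∈ W) →
      W = ⊥ ∨ W = fixedSpace e
  · exact exists_refines_of_irreducible hsub he hx hxe h
  · push Not at h
    obtain ⟨W, hWe, hW, hW₀, hW₁⟩ := h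
    exact exists_refines_of_reducible hG he horth hWe hW hW₀ hW₁

end Refinement

/-! ### Primitive idempotents of a commutative algebra. -/

section Primitive

variable {n : ℕ}

/-- `e` is a nonzero idempotent of `B` with `B e = ℂ e`. -/
structure IsPrimitiveIdempotent (B : Subalgebra ℂ (Matrix (Fin n) (Fin n) ℂ))
    (e : Matrix (Fin n) (Fin n) ℂ) : Prop where
  mem : e ∈ B
  mul_self : e * e = e
  ne_zero : e ≠ 0
  exists_smul : ∀ b ∈ B, ∃ c : ℂ, b * e = c • e

variable {B : Subalgebra ℂ (Matrix (Fin n) (Fin n) ℂ)} {e f : Matrix (Fin n) (Fin n) ℂ}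

/-- The product `e * f` is a multiple of both `e` and `f`. If it is nonzero, its idempotence forces
both factors to be 1, so `e = f`. -/
theorem IsPrimitiveIdempotent.mul_eq_zero (hB : ∀ x ∈ B, ∀ y ∈ B, x * y = y * x)
    (he : IsPrimitiveIdempotent B e) (hf : IsPrimitiveIdempotent B f) (h : e ≠ f) :
    e * f = 0 := by
  obtain ⟨c, hc⟩ := he.exists_smul f hf.mem
  obtain ⟨d, hd⟩ := hf.exists_smul e he.mem
  rw [hB f hf.mem e he.mem] at hc
  by_contra h0
  have h1 : e * f = e := by
    have h2 : c • (e * f) = e * f := by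
      have : e * (e * f) * f = e * f := by
        rw [← mul_assoc, he.mul_self, mul_assoc, hf.mul_self]
      nth_rw 1 [hc, mul_smul_comm, he.mul_self, smul_mul_assoc] at this
      exact this
    have h3 : c = 1 := by
      by_contra hne
      have : (c - 1) • (e * f) = 0 := by rw [sub_smul, h2, one_smul, sub_self]
      exact (smul_eq_zero.1 this).elim (fun h => hne (sub_eq_zero.1 h)) h0
    rw [hc, h3, one_smul]
  have h1' : e * f = f := by
    have h2 : d • (e * f) = e * f := by
      have : e * (e * f) * f = e * f := by
        rw [← mul_assoc, he.mul_self, mul_assoc, hf.mul_self]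
      nth_rw 1 [hd, mul_smul_comm, smul_mul_assoc, mul_assoc, hf.mul_self] at this
      exact this
    have h3 : d = 1 := by
      by_contra hne
      have : (d - 1) • (e * f) = 0 := by rw [sub_smul, h2, one_smul, sub_self]
      exact (smul_eq_zero.1 this).elim (fun h => hne (sub_eq_zero.1 h)) h0
    rw [hd, h3, one_smul]
  exact h (h1.symm.trans h1')

/-- In a reduced commutative algebra of matrices, `1` is a sum of primitive idempotents. -/
theorem exists_sum_primitiveIdempotent_eq_one (hB : ∀ x ∈ B, ∀ y ∈ B, x * y = y * x)
    (hred : ∀ x ∈ B, IsNilpotent x → x = 0) :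
    ∃ (ι : Type) (_ : Fintype ι) (f : ι → Matrix (Fin n) (Fin n) ℂ),
      (∀ i, IsPrimitiveIdempotent B (f i)) ∧ ∑ i, f i = 1 := by
  classical
  let _ : CommRing B := { (inferInstance : Ring B) with
    mul_comm := fun x y => Subtype.ext (hB x x.2 y y.2) }
  have : IsReduced B := ⟨fun x ⟨k, hk⟩ => Subtype.ext
    (hred x x.2 ⟨k, by simpa using congrArg Subtype.val hk⟩)⟩
  have : IsArtinianRing B := IsArtinianRing.of_finite ℂ B
  -- A reduced commutative Artinian ring is the product of its residue fields, each of which is `ℂ`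
  -- here; the idempotents are the coordinate units.
  let φ := IsArtinianRing.equivPi B
  have : Fintype (MaximalSpectrum B) := Fintype.ofFinite _
  let u : MaximalSpectrum B → B := fun I => φ.symm (Pi.single I 1)
  refine ⟨MaximalSpectrum B, inferInstance, fun I => (u I : Matrix (Fin n) (Fin n) ℂ),
    fun I => ⟨(u I).2, ?_, ?_, ?_⟩, ?_⟩
  · have : u I * u I = u I := by
      rw [← map_mul, ← Pi.single_mul, one_mul]
    exact congrArg Subtype.val this
  · intro h
    have h1 : u I = 0 := Subtype.ext h
    have h2 : (Pi.single I 1 : ∀ I : MaximalSpectrum B, B ⧸ I.asIdeal) = 0 :=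
      (EmbeddingLike.map_eq_zero_iff (f := φ.symm)).1 h1
    have h3 := congrFun h2 I
    rw [Pi.single_eq_same, Pi.zero_apply] at h3
    have : I.asIdeal ≠ ⊤ := I.isMaximal.ne_top
    have : Nontrivial (B ⧸ I.asIdeal) := Ideal.Quotient.nontrivial_iff.2 this
    exact one_ne_zero h3
  · intro b hb
    have := I.isMaximal
    have : Module.Finite ℂ (B ⧸ I.asIdeal) :=
      Module.Finite.of_surjective (Ideal.Quotient.mkₐ ℂ I.asIdeal).toLinearMap
        Ideal.Quotient.mk_surjective
    obtain ⟨c, hc⟩ := (IsAlgClosed.algebraMap_bijective_of_isIntegral (k := ℂ)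
      (K := B ⧸ I.asIdeal)).2 (Ideal.Quotient.mk _ ⟨b, hb⟩)
    refine ⟨c, ?_⟩
    have : (⟨b, hb⟩ : B) * u I = algebraMap ℂ B c * u I := by
      refine φ.injective (funext fun J => ?_)
      rw [map_mul, map_mul, Pi.mul_apply, Pi.mul_apply, AlgEquiv.apply_symm_apply]
      rcases eq_or_ne J I with rfl | hJ
      · rw [Pi.single_eq_same, mul_one, mul_one]
        exact hc.symm
      · rw [Pi.single_eq_of_ne hJ, mul_zero, mul_zero]
    rw [← Algebra.smul_def] at this
    exact congrArg Subtype.val this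
  · have : ∑ I, u I = 1 := by
      rw [← map_sum, Finset.univ_sum_single (fun _ => 1)]
      exact map_one φ.symm
    have h2 := congrArg B.val this
    rw [map_sum, map_one] at h2
    exact h2

theorem IsPrimitiveIdempotent.conj {g : GL (Fin n) ℂ} (hB : ∀ b ∈ B, conjAlgHom g b ∈ B)
    (hB' : ∀ b ∈ B, conjAlgHom g⁻¹ b ∈ B) (he : IsPrimitiveIdempotent B e) :
    IsPrimitiveIdempotent B (conjAlgHom g e) where
  mem := hB e he.mem
  mul_self := by rw [← map_mul, he.mul_self]
  ne_zero h := by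
    have := congrArg (conjAlgHom g⁻¹) h
    rw [← conjAlgHom_mul, inv_mul_cancel, conjAlgHom_one, map_zero] at this
    exact he.ne_zero this
  exists_smul b hb := by
    obtain ⟨c, hc⟩ := he.exists_smul _ (hB' b hb)
    refine ⟨c, ?_⟩
    rw [← conjAlgHom_conjAlgHom_inv g b, ← map_mul, hc, map_smul]

end Primitive

/-! ### Enlarging invariant algebras up to a self-centralizing one. -/

section Main

variable {n : ℕ}

/-- `B` is a `G`-invariant commutative algebra of semisimple matrices, self-adjoint if `u` holds. -/
structure IsToralInvariant (G : Subgroup (GL (Fin n) ℂ)) (u : Prop)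
    (B : Subalgebra ℂ (Matrix (Fin n) (Fin n) ℂ)) : Prop where
  comm : ∀ a ∈ B, ∀ b ∈ B, a * b = b * a
  isSemisimple : ∀ a ∈ B, IsSemisimpleMatrix a
  conj_mem : ∀ g ∈ G, ∀ a ∈ B, conjAlgHom g a ∈ B
  conjTranspose_mem : u → ∀ a ∈ B, aᴴ ∈ B

variable {G : Subgroup (GL (Fin n) ℂ)} {u : Prop}

/-- The algebra generated by an invariant set of commuting semisimple matrices. -/
theorem IsToralInvariant.adjoin {s : Set (Matrix (Fin n) (Fin n) ℂ)}
    (hc : ∀ a ∈ s, ∀ b ∈ s, a * b = b * a) (hs : ∀ a ∈ s, IsSemisimpleMatrix a)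
    (hG : ∀ g ∈ G, ∀ a ∈ s, conjAlgHom g a ∈ s) (hu : u → ∀ a ∈ s, aᴴ ∈ s) :
    IsToralInvariant G u (Algebra.adjoin ℂ s) where
  comm := by
    have := Algebra.isMulCommutative_adjoin ℂ hc
    intro x hx y hy
    exact setLike_mul_comm hx hy
  isSemisimple a ha := isSemisimpleMatrix_of_mem_adjoin hc hs ha
  conj_mem g hg a ha := by
    have : Algebra.adjoin ℂ s ≤ (Algebra.adjoin ℂ s).comap (conjAlgHom g) :=
      Algebra.adjoin_le fun a ha => Algebra.subset_adjoin (hG g hg a ha)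
    exact this ha
  conjTranspose_mem h a ha := by
    induction ha using Algebra.adjoin_induction with
    | mem a ha => exact Algebra.subset_adjoin (hu h a ha)
    | algebraMap c =>
      rw [Algebra.algebraMap_eq_smul_one, Matrix.conjTranspose_smul, Matrix.conjTranspose_one]
      exact Subalgebra.smul_mem _ (one_mem _) _
    | add x y _ _ h₁ h₂ => rw [Matrix.conjTranspose_add]; exact add_mem h₁ h₂
    | mul x y _ _ h₁ h₂ => rw [Matrix.conjTranspose_mul]; exact mul_mem h₂ h₁

theorem conjTranspose_conjAlgHom {g : GL (Fin n) ℂ}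
    (hg : (g : Matrix (Fin n) (Fin n) ℂ) ∈ Matrix.unitaryGroup (Fin n) ℂ)
    (a : Matrix (Fin n) (Fin n) ℂ) : (conjAlgHom g a)ᴴ = conjAlgHom g aᴴ := by
  have h1 : (g : Matrix (Fin n) (Fin n) ℂ)ᴴ = ((g⁻¹ : GL (Fin n) ℂ) : Matrix (Fin n) (Fin n) ℂ) := by
    have h : (g : Matrix (Fin n) (Fin n) ℂ)ᴴ * g = 1 := Matrix.mem_unitaryGroup_iff'.1 hg
    exact (Units.inv_eq_of_mul_eq_one_left h).symm
  rw [conjAlgHom_apply, conjAlgHom_apply, Matrix.conjTranspose_mul, Matrix.conjTranspose_mul, h1,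
    ← h1, Matrix.conjTranspose_conjTranspose, mul_assoc]

/-- A toral invariant algebra that commutes with a matrix outside of it is not maximal. -/
theorem IsToralInvariant.exists_lt (hG : IsCompletelyReducible G)
    (hsub : SubquotientsHaveNoncentralAbelianNormal G) (hu : u → IsUnitaryMatrixGroup G)
    {B : Subalgebra ℂ (Matrix (Fin n) (Fin n) ℂ)} (hB : IsToralInvariant G u B)
    {x : Matrix (Fin n) (Fin n) ℂ} (hx : ∀ b ∈ B, Commute x b) (hxB : x ∉ B) :
    ∃ B', IsToralInvariant G u B' ∧ B < B' := by
  obtain ⟨ι, _, f, hf, hsum⟩ := exists_sum_primitiveIdempotent_eq_one hB.comm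
    fun a ha hn => (hB.isSemisimple a ha).eq_zero_of_isNilpotent hn
  -- Otherwise `x`, the sum of the `x * f i`, would be a combination of the `f i` and lie in `B`.
  obtain ⟨i, hi⟩ : ∃ i, ∀ c : ℂ, x * f i ≠ c • f i := by
    by_contra! hcon
    choose c hc using hcon
    refine hxB ?_
    rw [← mul_one x, ← hsum, Finset.mul_sum]
    exact sum_mem fun i _ => by rw [hc]; exact Subalgebra.smul_mem _ (hf i).mem _
  have he := hf i
  set e := f i
  have hconj : ∀ g ∈ G, IsPrimitiveIdempotent B (conjAlgHom g e) := fun g hg =>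
    he.conj (hB.conj_mem g hg) (hB.conj_mem _ (G.inv_mem hg))
  have horth : ∀ g ∈ G, ¬ Commute (g : Matrix (Fin n) (Fin n) ℂ) e →
      e * (g : Matrix (Fin n) (Fin n) ℂ) * e = 0 := by
    intro g hg hne
    rw [← conjAlgHom_eq_self_iff] at hne
    have := he.mul_eq_zero hB.comm (hconj g hg) (Ne.symm hne)
    rw [conjAlgHom_apply, ← mul_assoc, ← mul_assoc] at this
    exact (Units.mul_left_eq_zero _).1 this
  obtain ⟨C, hC, hCu⟩ := exists_refines hG hsub he.mul_self horth (hx e he.mem) hi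
  -- After conjugating back by `g`, the element of `B` acts as a scalar on the range of `e`, where
  -- `a` lives.
  have hBC : ∀ b ∈ B, ∀ g ∈ G, ∀ a ∈ C, b * conjAlgHom g a = conjAlgHom g a * b := by
    intro b hb g hg a ha
    have hb' : conjAlgHom g⁻¹ b ∈ B := hB.conj_mem _ (G.inv_mem hg) b hb
    obtain ⟨c, hc⟩ := he.exists_smul _ hb'
    rw [← conjAlgHom_conjAlgHom_inv g b, ← map_mul, ← map_mul]
    congr 1
    nth_rw 1 [← hC.left_mul a ha]
    nth_rw 2 [← hC.right_mul a ha]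
    rw [← mul_assoc, hc, mul_assoc, hB.comm e he.mem _ hb', hc, smul_mul_assoc, mul_smul_comm,
      hC.left_mul a ha, hC.right_mul a ha]
  have hCC : ∀ g ∈ G, ∀ a ∈ C, ∀ h ∈ G, ∀ b ∈ C,
      conjAlgHom g a * conjAlgHom h b = conjAlgHom h b * conjAlgHom g a := by
    intro g hg a ha h hh b hb
    have hk : g⁻¹ * h ∈ G := G.mul_mem (G.inv_mem hg) hh
    have hgh : ∀ y, conjAlgHom h y = conjAlgHom g (conjAlgHom (g⁻¹ * h) y) := fun y => by
      rw [← conjAlgHom_mul, mul_inv_cancel_left]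
    rw [hgh, ← map_mul, ← map_mul]
    congr 1
    -- Either `g⁻¹ * h` stabilizes `e`, and both factors lie in `C`, or the two factors are
    -- supported by orthogonal idempotents and both products vanish.
    by_cases hc : Commute ((g⁻¹ * h : GL (Fin n) ℂ) : Matrix (Fin n) (Fin n) ℂ) e
    · refine hC.commute a ha _ ?_
      rw [conjAlgHom_apply]
      exact hC.conj_mem ⟨⟨g⁻¹ * h, hk⟩, hc⟩ b hb
    · rw [← conjAlgHom_eq_self_iff] at hc
      have h1 := he.mul_eq_zero hB.comm (hconj _ hk) (Ne.symm hc)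
      have h2 := (hconj _ hk).mul_eq_zero hB.comm he hc
      have h3 : a * conjAlgHom (g⁻¹ * h) b = 0 := by
        rw [← hC.right_mul a ha, ← hC.left_mul b hb, map_mul, mul_assoc, ← mul_assoc e, h1,
          zero_mul, mul_zero]
      have h4 : conjAlgHom (g⁻¹ * h) b * a = 0 := by
        rw [← hC.left_mul a ha, ← hC.right_mul b hb, map_mul, mul_assoc, ← mul_assoc _ e, h2,
          zero_mul, mul_zero]
      rw [h3, h4]
  let s : Set (Matrix (Fin n) (Fin n) ℂ) :=
    (B : Set (Matrix (Fin n) (Fin n) ℂ)) ∪ {y | ∃ g ∈ G, ∃ a ∈ C, y = conjAlgHom g a}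
  have hBs : B ≤ Algebra.adjoin ℂ s := fun b hb => Algebra.subset_adjoin (Or.inl hb)
  refine ⟨Algebra.adjoin ℂ s, IsToralInvariant.adjoin ?_ ?_ ?_ ?_, lt_of_le_of_ne hBs ?_⟩
  · rintro a (ha | ⟨g, hg, a, ha, rfl⟩) b (hb | ⟨h, hh, b, hb, rfl⟩)
    · exact hB.comm a ha b hb
    · exact hBC a ha h hh b hb
    · exact (hBC b hb g hg a ha).symm
    · exact hCC g hg a ha h hh b hb
  · rintro a (ha | ⟨g, hg, a, ha, rfl⟩)
    · exact hB.isSemisimple a ha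
    · exact (hC.isSemisimple a ha).conj g
  · rintro h hh a (ha | ⟨g, hg, a, ha, rfl⟩)
    · exact Or.inl (hB.conj_mem h hh a ha)
    · exact Or.inr ⟨h * g, G.mul_mem hh hg, a, ha, (conjAlgHom_mul h g a).symm⟩
  · rintro hu' a (ha | ⟨g, hg, a, ha, rfl⟩)
    · exact Or.inl (hB.conjTranspose_mem hu' a ha)
    · have hes : eᴴ = e := IsSelfAdjointAlgebra.conjTranspose_eq_of_idempotent
        (S := B.toNonUnitalSubalgebra) hB.comm (hB.conjTranspose_mem hu') he.mem he.mul_self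
      exact Or.inr ⟨g, hg, aᴴ, hCu (hu hu') hes a ha, conjTranspose_conjAlgHom (hu hu' g hg) a⟩
  -- Elements of `B` supported by `e` are multiples of `e`, but `C` contains one that is not.
  · intro hEq
    obtain ⟨a, ha, hne⟩ := hC.exists_ne
    have haB : a ∈ B := by
      rw [hEq]
      exact Algebra.subset_adjoin (Or.inr ⟨1, G.one_mem, a, ha, (conjAlgHom_one a).symm⟩)
    obtain ⟨c, hc⟩ := he.exists_smul a haB
    rw [hC.right_mul a ha] at hc
    exact hne c hc

/-- A toral invariant algebra is contained in one that is its own centralizer. -/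
theorem IsToralInvariant.exists_le_centralizer_le (hG : IsCompletelyReducible G)
    (hsub : SubquotientsHaveNoncentralAbelianNormal G) (hu : u → IsUnitaryMatrixGroup G)
    {B : Subalgebra ℂ (Matrix (Fin n) (Fin n) ℂ)} (hB : IsToralInvariant G u B) :
    ∃ B', IsToralInvariant G u B' ∧ B ≤ B' ∧ ∀ x, (∀ b ∈ B', Commute x b) → x ∈ B' := by
  have hwf : WellFounded fun S T : Subalgebra ℂ (Matrix (Fin n) (Fin n) ℂ) => T < S :=
    Subrelation.wf (r := InvImage (· > ·) (fun S : Subalgebra ℂ (Matrix (Fin n) (Fin n) ℂ) =>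
      Subalgebra.toSubmodule S)) (fun {S T} h => (Subalgebra.toSubmodule (R := ℂ)).strictMono h)
      (InvImage.wf _ (wellFounded_gt))
  obtain ⟨B', ⟨hB', hle⟩, hmax⟩ := hwf.has_min {S | IsToralInvariant G u S ∧ B ≤ S} ⟨B, hB, le_rfl⟩
  refine ⟨B', hB', hle, fun x hx => ?_⟩
  by_contra hxB
  obtain ⟨T, hT, hlt⟩ := hB'.exists_lt hG hsub hu hx hxB
  exact hmax T ⟨hT, hle.trans hlt.le⟩ hlt

/-- The proposition `u` switches the self-adjointness requirements on, so that one argument serves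
both the general and the unitary case. -/
theorem exists_invariant_maximal (hG : IsCompletelyReducible G)
    (hsub : SubquotientsHaveNoncentralAbelianNormal G) (hu : u → IsUnitaryMatrixGroup G)
    {A : NonUnitalSubalgebra ℂ (Matrix (Fin n) (Fin n) ℂ)} (hcomm : IsCommutativeAlgebra A)
    (hss : IsSemisimpleAlgebra A) (hinv : IsConjInvariant G A) (hA : u → IsSelfAdjointAlgebra A) :
    ∃ B : NonUnitalSubalgebra ℂ (Matrix (Fin n) (Fin n) ℂ),
      A ≤ B ∧ IsMaximalCommutativeSemisimple B ∧ IsConjInvariant G B ∧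
        (u → IsSelfAdjointAlgebra B) := by
  have hred := hcomm.isSemisimpleAlgebra_iff.1 hss
  have hA' : IsToralInvariant G u (Algebra.adjoin ℂ (A : Set (Matrix (Fin n) (Fin n) ℂ))) := by
    refine IsToralInvariant.adjoin hcomm (fun a ha => isSemisimpleMatrix_of_reduced hred ha)
      (fun g hg a ha => ?_) hA
    have := hinv g⁻¹ (G.inv_mem hg) a ha
    rwa [inv_inv, ← conjAlgHom_apply] at this
  obtain ⟨B, hB, hAB, hmax⟩ := hA'.exists_le_centralizer_le hG hsub hu
  have hBc : IsCommutativeAlgebra B.toNonUnitalSubalgebra := hB.comm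
  refine ⟨B.toNonUnitalSubalgebra, fun a ha => hAB (Algebra.subset_adjoin ha),
    ⟨⟨hBc, hBc.isSemisimpleAlgebra_iff.2 fun x hx hn =>
      (hB.isSemisimple x hx).eq_zero_of_isNilpotent hn⟩, ?_⟩, ?_, hB.conjTranspose_mem⟩
  · rintro T ⟨hT, -⟩ hBT x hx
    exact hmax x fun b hb => hT x hx b (hBT hb)
  · intro g hg a ha
    have := hB.conj_mem _ (G.inv_mem hg) a ha
    rwa [conjAlgHom_apply, inv_inv] at this

/-- A self-adjoint maximal commutative semisimple subalgebra is a masa. -/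
theorem IsMaximalCommutativeSemisimple.isMasa
    {B : NonUnitalSubalgebra ℂ (Matrix (Fin n) (Fin n) ℂ)}
    (hB : IsMaximalCommutativeSemisimple B) (hsa : IsSelfAdjointAlgebra B) : IsMasa B :=
  ⟨⟨hB.1.1, hsa⟩, fun _ hT hBT => hB.2 ⟨hT.1, hT.1.isSemisimpleAlgebra_iff.2
    fun _ hx hn => hT.2.eq_zero_of_isNilpotent hT.1 hx hn⟩ hBT⟩

end Main

theorem mainTheorem2 {n : ℕ} (G : Subgroup (GL (Fin n) ℂ)) (hG : IsCompletelyReducible G)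
    (hsub : SubquotientsHaveNoncentralAbelianNormal G)
    (A : NonUnitalSubalgebra ℂ (Matrix (Fin n) (Fin n) ℂ))
    (hcomm : IsCommutativeAlgebra A) (hss : IsSemisimpleAlgebra A) (hinv : IsConjInvariant G A) :
    (∃ B : NonUnitalSubalgebra ℂ (Matrix (Fin n) (Fin n) ℂ),
      A ≤ B ∧ IsMaximalCommutativeSemisimple B ∧ IsConjInvariant G B) ∧
    (IsUnitaryMatrixGroup G → IsSelfAdjointAlgebra A →
      ∃ B : NonUnitalSubalgebra ℂ (Matrix (Fin n) (Fin n) ℂ),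
        A ≤ B ∧ IsMaximalCommutativeSemisimple B ∧ IsMasa B ∧ IsConjInvariant G B) := by

  refine ⟨?_, fun hu hsa => ?_⟩
  · obtain ⟨B, hAB, hB, hBG, -⟩ := exists_invariant_maximal (u := False) hG hsub (fun h => h.elim)
      hcomm hss hinv (fun h => h.elim)
    exact ⟨B, hAB, hB, hBG⟩
  · obtain ⟨B, hAB, hB, hBG, hBsa⟩ := exists_invariant_maximal (u := True) hG hsub (fun _ => hu)
      hcomm hss hinv (fun _ => hsa)
    exact ⟨B, hAB, hB, hB.isMasa (hBsa trivial), hBG⟩
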